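/- Let $\mathbb K$ be a field, $n\ge 1$, $a_1,\dots,a_n\ge 1$ integers, and let $A=(x_{i_1,\dots,i_n})$ be the generic $a_1\times\cdots\times a_n$ table, with entries the variables of $R=\mathbb K[x_{i_1,\dots,i_n}\mid 1\le i_j\le a_j]$. For $J\subset\{1,\dots,n\}$ let $A_J$ be the $J$-margin of $A$, the table indexed by $(i_j)_{j\in J}$ obtained from $A$ by summing over all indices $i_j$ with $j\notin J$. Let $L_J\subset R$ be the ideal generated by the entries of $A_J$, and let $I(A_J)\subset R$ be the ideal generated by the generalized $2\times 2$ minors of $A_J$, that is, by the elements $b_u b_v-b_{u'}b_{v'}$, where $b_w$ denotes the entry of $A_J$ at index $w$, and $u',v'$ arise from indices $u,v$ by interchanging a single coordinate. For a collection $\Gamma$ of subsets of $\{1,\dots,n\}$ put $L_\Gamma=\sum_{J\in\Gamma}L_J$ and $I_\Gamma=\sum_{J\in\Gamma}I(A_J)$. Let $S_\Gamma$ be the polynomial ring over $\mathbb K$ with one variable for each entry of each $A_J$, $J\in\Gamma$; let $\tau_\Gamma\colon S_\Gamma\to R$ send each variable to the corresponding entry of $A_J$, and let $\sigma_\Gamma\colon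 S_\Gamma\to\mathbb K[y_{j,i}\mid 1\le j\le n,\ 1\le i\le a_j]$ be $\tau_\Gamma$ followed by the $\mathbb K$-algebra homomorphism $x_{i_1,\dots,i_n}\mapsto\prod_j y_{j,i_j}$. Let $P_\Gamma\subset R$ be the ideal generated by $\tau_\Gamma(\ker\sigma_\Gamma)$. If $k$ lies in every member of $\Gamma$, put $\Gamma\smallsetminus k=\{J\smallsetminus\{k\}\mid J\in\Gamma\}$. Let $\Delta$ be a simplicial complex on $\{1,\dots,n\}$, i.e. a collection of subsets closed under taking subsets. Then: (1) Let $\Delta_1\sqcup\cdots\sqcup\Delta_r$ be a partition of the set of facets of $\Delta$ into non-empty parts, and for each $i$ let $K_i\subset\bigcap_{J\in\Delta_i}J$ be a set such that $K_i\smallsetminus J\neq\emptyset$ for every facet $J$ of $\Delta$ not in $\Delta_i$. Then $$\mathfrak a=\sum_{i}P_{\Delta_i}+\sum_{i}\sum_{k\in K_i}L_{\Delta_i\smallsetminus k}$$ is a prime ideal of $R$. (2) Every minimal prime over $I_\Delta$ is equal to one of the ideals $\mathfrak a$ of (1), for some partition of the facets and some sets $K_i$ as in (1). -/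

import Mathlib

open scoped BigOperators

namespace MarginalIndependence

noncomputable section

/-- The `2 × 2` minor of a multiway table `B` about the coordinate `l`: the determinant of
`!![B i, B (j with l-th coordinate i l); B (i with l-th coordinate j l), B j]`. -/
def minor {ι : Type*} [DecidableEq ι] {α : ι → Type*} {R : Type*} [CommRing R]
    (B : (∀ j, α j) → R) (l : ι) (i j : ∀ j, α j) : R :=
  Matrix.det !![B i, B (Function.update j l (i l)); B (Function.update i l (j l)), B j]

/-- The ideal `I(B)` of complete independence of a multiway table `B`, generated by all its
`2 × 2` minors (interchanges of one coordinate). -/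
def segreIdeal {ι : Type*} [DecidableEq ι] {α : ι → Type*} {R : Type*} [CommRing R]
    (B : (∀ j, α j) → R) : Ideal R :=
  Ideal.span {f | ∃ (l : ι) (i j : ∀ j, α j), f = minor B l i j}

/-- The index set of an `a 0 × ⋯ × a (n-1)` table. -/
abbrev Cell {n : ℕ} (a : Fin n → ℕ) : Type := ∀ j : Fin n, Fin (a j)

/-- The index set of the `J`-margin of such a table. -/
abbrev MarginCell {n : ℕ} (a : Fin n → ℕ) (J : Finset (Fin n)) : Type :=
  ∀ j : {j : Fin n // j ∈ J}, Fin (a j.1)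

/-- The `J`-margin of a table: sum over all coordinates outside `J`. -/
def margin {n : ℕ} {a : Fin n → ℕ} {R : Type*} [CommRing R] (A : Cell a → R)
    (J : Finset (Fin n)) (b : MarginCell a J) : R :=
  ∑ i : Cell a with ∀ j : {j : Fin n // j ∈ J}, i j.1 = b j, A i

/-- The ring `𝕂[x_{i_1,…,i_n}]`. -/
abbrev TableRing (𝕂 : Type*) [Field 𝕂] {n : ℕ} (a : Fin n → ℕ) := MvPolynomial (Cell a) 𝕂

/-- The generic table. -/
def generic (𝕂 : Type*) [Field 𝕂] {n : ℕ} (a : Fin n → ℕ) : Cell a → TableRing 𝕂 a :=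
  fun i => MvPolynomial.X i

/-- `I_Δ`: the sum of the ideals `I(A_J)`, `J ∈ Δ`, for the generic table `A`. -/
def independenceIdeal (𝕂 : Type*) [Field 𝕂] {n : ℕ} (a : Fin n → ℕ)
    (Δ : Finset (Finset (Fin n))) : Ideal (TableRing 𝕂 a) :=
  ⨆ J ∈ Δ, segreIdeal (margin (generic 𝕂 a) J)

/-- `L_J`: the ideal generated by the entries of the `J`-margin of the generic table. -/
def marginIdeal (𝕂 : Type*) [Field 𝕂] {n : ℕ} (a : Fin n → ℕ) (J : Finset (Fin n)) :
    Ideal (TableRing 𝕂 a) :=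
  Ideal.span (Set.range (margin (generic 𝕂 a) J))

/-- `L_Γ`: the sum of the `L_J`, `J ∈ Γ`. -/
def marginsIdeal (𝕂 : Type*) [Field 𝕂] {n : ℕ} (a : Fin n → ℕ) (Γ : Finset (Finset (Fin n))) :
    Ideal (TableRing 𝕂 a) :=
  ⨆ J ∈ Γ, marginIdeal 𝕂 a J

/-- The ring `S_Γ`: one variable for each entry of each `J`-margin, `J ∈ Γ`. -/
abbrev MarginRing (𝕂 : Type*) [Field 𝕂] {n : ℕ} (a : Fin n → ℕ) (Γ : Finset (Finset (Fin n))) :=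
  MvPolynomial (Σ J : {J : Finset (Fin n) // J ∈ Γ}, MarginCell a J.1) 𝕂

/-- `τ_Γ`: a formal margin variable goes to the corresponding margin of the generic table. -/
def tau (𝕂 : Type*) [Field 𝕂] {n : ℕ} (a : Fin n → ℕ) (Γ : Finset (Finset (Fin n))) :
    MarginRing 𝕂 a Γ →ₐ[𝕂] TableRing 𝕂 a :=
  MvPolynomial.aeval fun s => margin (generic 𝕂 a) s.1.1 s.2

/-- The parametrization `x_{i_1,…,i_n} ↦ ∏ j, y_{j,i_j}` of the Segre variety. -/
def segreMap (𝕂 : Type*) [Field 𝕂] {n : ℕ} (a : Fin n → ℕ) :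
    TableRing 𝕂 a →ₐ[𝕂] MvPolynomial (Σ j : Fin n, Fin (a j)) 𝕂 :=
  MvPolynomial.aeval fun i => ∏ j : Fin n, MvPolynomial.X (Sigma.mk j (i j))

/-- `σ_Γ`, the composite of `τ_Γ` with the Segre parametrization. -/
def sigma (𝕂 : Type*) [Field 𝕂] {n : ℕ} (a : Fin n → ℕ) (Γ : Finset (Finset (Fin n))) :
    MarginRing 𝕂 a Γ →ₐ[𝕂] MvPolynomial (Σ j : Fin n, Fin (a j)) 𝕂 :=
  (segreMap 𝕂 a).comp (tau 𝕂 a Γ)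

/-- `P_Γ` as an ideal of `𝕂[x_{i_1,…,i_n}]`: the ideal generated there by the image of `ker σ_Γ`,
i.e. by the polynomials in the `Γ`-margins that vanish on the Segre variety.
(It depends only on the simplicial complex generated by `Γ`.) -/
def mainIdeal (𝕂 : Type*) [Field 𝕂] {n : ℕ} (a : Fin n → ℕ) (Γ : Finset (Finset (Fin n))) :
    Ideal (TableRing 𝕂 a) :=
  (RingHom.ker (sigma 𝕂 a Γ)).map (tau 𝕂 a Γ)

open Classical in
/-- The facets (maximal faces) of `Δ`. -/
def facets {n : ℕ} (Δ : Finset (Finset (Fin n))) : Finset (Finset (Fin n)) :=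
  Δ.filter fun J => Maximal (fun F => F ∈ Δ) J

/-- `Γ ∖ k`: remove the vertex `k` from every member of `Γ`. -/
def deleteVertex {n : ℕ} (Γ : Finset (Finset (Fin n))) (k : Fin n) : Finset (Finset (Fin n)) :=
  Γ.image fun J => J.erase k

/-- A choice `κ Γ` of a set for each part `Γ` of a partition of the facets of `Δ`, such that
`κ Γ` is contained in all facets in `Γ` and in no facet outside `Γ`. -/
def Admissible {n : ℕ} {Δ : Finset (Finset (Fin n))} (π : Finpartition (facets Δ))
    (κ : Finset (Finset (Fin n)) → Finset (Fin n)) : Prop :=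
  ∀ Γ ∈ π.parts, (∀ J ∈ Γ, κ Γ ⊆ J) ∧ ∀ J ∈ facets Δ, J ∉ Γ → (κ Γ \ J).Nonempty

/-- `∑_Γ P_Γ + ∑_Γ ∑_{k ∈ κ Γ} L_{Γ ∖ k}`, `Γ` running over the parts of the partition. -/
def componentIdeal (𝕂 : Type*) [Field 𝕂] {n : ℕ} (a : Fin n → ℕ) {Δ : Finset (Finset (Fin n))}
    (π : Finpartition (facets Δ)) (κ : Finset (Finset (Fin n)) → Finset (Fin n)) :
    Ideal (TableRing 𝕂 a) :=
  (⨆ Γ ∈ π.parts, mainIdeal 𝕂 a Γ) ⊔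
    ⨆ Γ ∈ π.parts, ⨆ k ∈ κ Γ, marginsIdeal 𝕂 a (deleteVertex Γ k)

end

end MarginalIndependence

/-!
Let the index `0` of each coordinate stand for summing that coordinate out, and let `p_w` be the
entry at `w` of the margin over the set of nonzero coordinates of `w`. The `p_w` are linear
coordinates on `R` adapted to all margins at once: `L_J` is generated by the `p_w` with `w`
supported in `J`, and the Segre parametrization becomes, after a linear change of its parameters,
`p_w ↦ ∏ j, η_{j, w_j}`.

In these coordinates an ideal `𝔞` of the theorem is the kernel of a homomorphism to a polynomial
ring, so it is prime: `p_w` is sent to `0` if `w` lies in a face of `Δ_i` and vanishes somewhere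
on `K_i`, to a Segre monomial in variables belonging to `Δ_i` if `w` lies in a face of `Δ_i` and
is nonzero on `K_i`, and to a variable of its own if `w` lies in no face. The condition on the
`K_i` makes the cases exclusive. The kernel is spanned by the monomials sent to `0` and the
differences of monomials with equal images, and these factor over the parts `Δ_i`.

Conversely, modulo a prime `𝔭` over `I_Δ` the `p_w` with `w` supported in a facet `J` satisfy the
equations of a rank-one table. Let `K(J)` be the set of coordinates in `J` that are nonzero at
each of these `w` with `p_w ∉ 𝔭`. Facets with the same `K(J)` have a common rank-one
factorization, so grouping the facets by `K(J)` yields an ideal `𝔞 ⊆ 𝔭`. Since `𝔞`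
is itself a prime over `I_Δ`, it equals `𝔭` if `𝔭` is minimal.
-/

namespace MarginalIndependence

section MultiwayTables

variable {ι : Type*} [DecidableEq ι] {α : ι → Type*} {R S : Type*} [CommRing R] [CommRing S]

theorem minor_eq_zero_iff {B : (∀ j, α j) → R} {l : ι} {i j : ∀ j, α j} :
    minor B l i j = 0 ↔
      B i * B j = B (Function.update i l (j l)) * B (Function.update j l (i l)) := by
  rw [minor, Matrix.det_fin_two_of, sub_eq_zero, mul_comm (B (Function.update i l _))]

theorem map_minor {F : Type*} [FunLike F R S] [RingHomClass F R S] (f : F) (B : (∀ j, α j) → R)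
    (l : ι) (i j : ∀ j, α j) :
    f (minor B l i j) = minor (fun b => f (B b)) l i j := by
  simp [minor, Matrix.det_fin_two_of]

variable [Fintype ι]

theorem minor_prod (y : ∀ j, α j → R) (l : ι) (i i' : ∀ j, α j) :
    minor (fun b => ∏ j, y j (b j)) l i i' = 0 := by
  rw [minor_eq_zero_iff, ← Finset.prod_mul_distrib, ← Finset.prod_mul_distrib]
  refine Finset.prod_congr rfl fun j _ => ?_
  rcases eq_or_ne j l with rfl | hj
  · simp [mul_comm]
  · simp [hj]

/-- The sum of the entries of a table over a box. Margins, and margins of margins, are box sums. -/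
def boxSum {M : Type*} [AddCommMonoid M] (B : (∀ j, α j) → M) (s : ∀ j, Finset (α j)) : M :=
  ∑ b ∈ Fintype.piFinset s, B b

theorem update_mem_piFinset_update {s : ∀ j, Finset (α j)} {b : ∀ j, α j}
    (hb : b ∈ Fintype.piFinset s) {l : ι} {u : Finset (α l)} {c : α l} (hc : c ∈ u) :
    Function.update b l c ∈ Fintype.piFinset (Function.update s l u) := by
  refine Fintype.mem_piFinset.2 fun j => ?_
  rcases eq_or_ne j l with rfl | hj
  · simpa using hc
  · simpa [hj] using Fintype.mem_piFinset.1 hb j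

-- Interchanging the `l`-th coordinates is an involution on the pairs of cells in the two boxes.
theorem boxSum_mul_boxSum {B : (∀ j, α j) → R} {l : ι} (h : ∀ i j, minor B l i j = 0)
    (s t : ∀ j, Finset (α j)) :
    boxSum B s * boxSum B t =
      boxSum B (Function.update s l (t l)) * boxSum B (Function.update t l (s l)) := by
  let swap : (∀ j, α j) × (∀ j, α j) → (∀ j, α j) × (∀ j, α j) := fun p =>
    (Function.update p.1 l (p.2 l), Function.update p.2 l (p.1 l))
  have swap_swap (p) : swap (swap p) = p := by simp [swap]
  have swap_mem (s t : ∀ j, Finset (α j)) (p) (hp : p ∈ Fintype.piFinset s ×ˢ Fintype.piFinset t) :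
      swap p ∈ Fintype.piFinset (Function.update s l (t l)) ×ˢ
        Fintype.piFinset (Function.update t l (s l)) := by
    obtain ⟨h₁, h₂⟩ := Finset.mem_product.1 hp
    exact Finset.mem_product.2
      ⟨update_mem_piFinset_update h₁ (Fintype.mem_piFinset.1 h₂ l),
        update_mem_piFinset_update h₂ (Fintype.mem_piFinset.1 h₁ l)⟩
  simp only [boxSum, Finset.sum_mul_sum, ← Finset.sum_product']
  refine Finset.sum_nbij' swap swap (swap_mem s t) (fun p hp => ?_)
    (fun p _ => swap_swap p) (fun p _ => swap_swap p) fun p _ => minor_eq_zero_iff.1 (h p.1 p.2)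
  simpa using swap_mem _ _ p hp

end MultiwayTables

section Support

variable {ι : Type*} [Fintype ι] {α : ι → Type*} [∀ j, Zero (α j)] [∀ j, DecidableEq (α j)]

/-- The set of nonzero coordinates of a cell. The index `0` of each coordinate is singled out: in
`faceSum` it stands for a coordinate that has been summed out. -/
def support (w : ∀ j, α j) : Finset ι := Finset.univ.filter fun j => w j ≠ 0

@[simp] theorem mem_support {w : ∀ j, α j} {j : ι} : j ∈ support w ↔ w j ≠ 0 := by simp [support]

theorem eq_zero_of_notMem {J : Finset ι} {w : ∀ j, α j} (hw : support w ⊆ J) {j : ι}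
    (hj : j ∉ J) : w j = 0 :=
  not_not.1 fun h => hj (hw (mem_support.2 h))

theorem support_update_subset [DecidableEq ι] {J : Finset ι} {w : ∀ j, α j} (hw : support w ⊆ J)
    {l : ι} {c : α l} (hc : c ≠ 0 → l ∈ J) : support (Function.update w l c) ⊆ J := by
  intro j hj
  rcases eq_or_ne j l with rfl | hjl
  · exact hc (by simpa using hj)
  · exact hw (by simpa [hjl] using hj)

theorem exists_restrict_eq (J : Finset ι) (b : ∀ j : J, α j) :
    ∃ i : ∀ j, α j, support i ⊆ J ∧ J.restrict i = b := by
  classical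
  refine ⟨fun j => if h : j ∈ J then b ⟨j, h⟩ else 0, fun j hj => ?_, ?_⟩
  · by_contra h
    simp [h] at hj
  · ext j
    simp

/-- The cells that label the entries `faceSum` of the `J`-margins with `J` in, or contained in a
member of, the collection `Γ`. -/
def InFace (Γ : Finset (Finset ι)) (w : ∀ j, α j) : Prop := ∃ J ∈ Γ, support w ⊆ J

end Support

section Slot

variable {α : Type*} [Fintype α] [DecidableEq α] [Zero α]

/-- The index `0` stands for the full range of a coordinate, any other index for itself. -/
def slot (c : α) : Finset α := if c = 0 then Finset.univ else {c}

theorem exists_sum_slot_eq {M : Type*} [AddCommGroup M] (η : α → M) :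
    ∃ y : α → M, ∀ c, ∑ d ∈ slot c, y d = η c := by
  refine ⟨Function.update η 0 (η 0 - ∑ d ∈ Finset.univ.erase 0, η d), fun c => ?_⟩
  by_cases hc : c = 0
  · subst hc
    rw [slot, if_pos rfl, ← Finset.add_sum_erase _ _ (Finset.mem_univ 0), Function.update_self,
      Finset.sum_congr rfl fun d hd => Function.update_of_ne (Finset.ne_of_mem_erase hd) _ _,
      sub_add_cancel]
  · simp [slot, hc]

end Slot

section Margins

variable {n : ℕ} {a : Fin n → ℕ} {R S : Type*} [CommRing R] [CommRing S]

theorem map_margin {F : Type*} [FunLike F R S] [AddMonoidHomClass F R S] (f : F) (A : Cell a → R)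
    (J : Finset (Fin n)) (b : MarginCell a J) :
    f (margin A J b) = margin (fun i => f (A i)) J b := by
  simp [margin]

theorem margin_restrict_eq_boxSum (A : Cell a → R) (J : Finset (Fin n)) (i : Cell a) :
    margin A J (J.restrict i) = boxSum A fun j => if j ∈ J then {i j} else Finset.univ := by
  refine Finset.sum_congr ?_ fun _ _ => rfl
  ext v
  simp only [Finset.mem_filter, Finset.mem_univ, true_and, Subtype.forall, Fintype.mem_piFinset]
  refine forall_congr' fun j => ?_
  by_cases hj : j ∈ J <;> simp [hj]

theorem margin_erase_restrict (A : Cell a → R) {J : Finset (Fin n)} {k : Fin n} (hk : k ∈ J)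
    (i : Cell a) :
    margin A (J.erase k) ((J.erase k).restrict i) =
      ∑ c, margin A J (J.restrict (Function.update i k c)) := by
  unfold margin
  rw [← Finset.sum_fiberwise _ fun v : Cell a => v k]
  refine Finset.sum_congr rfl fun c _ => Finset.sum_congr ?_ fun _ _ => rfl
  ext v
  simp only [Finset.mem_filter, Finset.mem_univ, true_and, Subtype.forall, Finset.restrict,
    Finset.mem_erase]
  constructor
  · rintro ⟨h, rfl⟩ j hj
    rcases eq_or_ne j k with rfl | hjk
    · simp
    · simpa [hjk] using h j ⟨hjk, hj⟩
  · intro h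
    exact ⟨fun j hj => by simpa [hj.1] using h j hj.2, by simpa using h k hk⟩

variable [∀ j, NeZero (a j)]

theorem minor_margin_eq_zero {A : Cell a → R} (h : ∀ l i j, minor A l i j = 0)
    (J : Finset (Fin n)) (l : {j // j ∈ J}) (b b' : MarginCell a J) :
    minor (margin A J) l b b' = 0 := by
  obtain ⟨i, -, rfl⟩ := exists_restrict_eq (α := fun j => Fin (a j)) J b
  obtain ⟨i', -, rfl⟩ := exists_restrict_eq (α := fun j => Fin (a j)) J b'
  have restrict_update (i i' : Cell a) : Function.update (J.restrict i) l (J.restrict i' l) =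
      J.restrict (Function.update i l (i' l)) := by
    ext j
    rcases eq_or_ne j l with rfl | hj
    · simp
    · simp [hj, Subtype.coe_ne_coe.2 hj]
  let box (i : Cell a) (j : Fin n) : Finset (Fin (a j)) := if j ∈ J then {i j} else Finset.univ
  have box_update (i i' : Cell a) :
      Function.update (box i) l (box i' l) = box (Function.update i l (i' l)) := by
    ext1 j
    rcases eq_or_ne j l with rfl | hj
    · simp [box]
    · simp [box, hj]
  simp only [minor_eq_zero_iff, restrict_update, margin_restrict_eq_boxSum]
  exact (boxSum_mul_boxSum (h l) _ _).trans (by rw [box_update, box_update])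

/-- The entry at `w` of the margin over the support of `w`. As `w` varies, these linear forms are
coordinates adapted to all the margins at once. -/
def faceSum (A : Cell a → R) (w : Cell a) : R := margin A (support w) ((support w).restrict w)

theorem map_faceSum {F : Type*} [FunLike F R S] [AddMonoidHomClass F R S] (f : F) (A : Cell a → R)
    (w : Cell a) :
    f (faceSum A w) = faceSum (fun i => f (A i)) w :=
  map_margin f A _ _

theorem faceSum_eq_boxSum (A : Cell a → R) (w : Cell a) :
    faceSum A w = boxSum A fun j => slot (w j) := by
  simp [faceSum, margin_restrict_eq_boxSum, slot, ite_not]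

theorem faceSum_eq_boxSum_margin (A : Cell a → R) {J : Finset (Fin n)} {w : Cell a}
    (hw : support w ⊆ J) : faceSum A w = boxSum (margin A J) fun j => slot (w j) := by
  rw [faceSum_eq_boxSum, boxSum, ← Finset.sum_fiberwise_of_maps_to (g := J.restrict)
    (t := Fintype.piFinset fun j : {j // j ∈ J} => slot (w j))]
  · refine Finset.sum_congr rfl fun b hb => Finset.sum_congr ?_ fun _ _ => rfl
    ext i
    simp only [Finset.mem_filter, Finset.mem_univ, true_and, Fintype.mem_piFinset] at hb ⊢
    refine ⟨fun h j => congr_fun h.2 j, fun h => ⟨fun j => ?_, funext h⟩⟩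
    by_cases hj : j ∈ J
    · exact h ⟨j, hj⟩ ▸ hb ⟨j, hj⟩
    · simp [slot, eq_zero_of_notMem hw hj]
  · exact fun i hi => Fintype.mem_piFinset.2 fun j => Fintype.mem_piFinset.1 hi j

-- A coordinate `k` of `J` with `i k = 0` is eliminated by subtracting from the `J.erase k`-margin
-- the entries of the `J`-margin whose `k`-th coordinate is nonzero.
theorem margin_restrict_mem {A : Cell a → R} {M : AddSubgroup R} {J : Finset (Fin n)}
    (h : ∀ w, support w ⊆ J → faceSum A w ∈ M) (i : Cell a) (hi : support i ⊆ J) :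
    margin A J (J.restrict i) ∈ M := by
  induction hs : J \ support i using Finset.strongInduction generalizing J i with
  | H s ih =>
    subst hs
    by_cases hJ : J ⊆ support i
    · obtain rfl := hi.antisymm hJ
      exact h i subset_rfl
    obtain ⟨k, hkJ, hki⟩ := Finset.not_subset.1 hJ
    have hk0 : i k = 0 := by simpa using hki
    have hk : k ∈ J \ support i := Finset.mem_sdiff.2 ⟨hkJ, hki⟩
    have herase : margin A (J.erase k) ((J.erase k).restrict i) ∈ M := by
      refine ih _ ?_ (fun w hw => h w (hw.trans (Finset.erase_subset k J))) i
        (Finset.subset_erase.2 ⟨hi, hki⟩) rfl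
      exact Finset.erase_sdiff_comm J _ k ▸ Finset.erase_ssubset hk
    have hnonzero : ∀ c ∈ Finset.univ.erase (0 : Fin (a k)),
        margin A J (J.restrict (Function.update i k c)) ∈ M := fun c hc => by
      refine ih _ ?_ h _ (support_update_subset hi fun _ => hkJ) rfl
      refine (Finset.ssubset_iff_of_subset fun j hj => ?_).2
        ⟨k, hk, by simp [Finset.ne_of_mem_erase hc]⟩
      rcases eq_or_ne j k with rfl | hjk
      · exact hk
      · simpa [hjk] using hj
    rw [margin_erase_restrict A hkJ, ← Finset.add_sum_erase _ _ (Finset.mem_univ 0),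
      ← hk0, Function.update_eq_self, hk0] at herase
    exact (M.add_mem_cancel_right (M.sum_mem hnonzero)).1 herase

theorem forall_margin_mem_iff {A : Cell a → R} {M : AddSubgroup R} {J : Finset (Fin n)} :
    (∀ b, margin A J b ∈ M) ↔ ∀ w, support w ⊆ J → faceSum A w ∈ M := by
  refine ⟨fun h w hw => ?_, fun h b => ?_⟩
  · rw [faceSum_eq_boxSum_margin A hw]
    exact sum_mem fun b _ => h b
  · obtain ⟨i, hi, rfl⟩ := exists_restrict_eq (α := fun j => Fin (a j)) J b
    exact margin_restrict_mem h i hi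

end Margins

section Algebra

theorem injective_of_surjective_of_isNoetherianRing {R : Type*} [CommRing R] [IsNoetherianRing R]
    {f : R →+* R} (hf : Function.Surjective f) : Function.Injective f := by
  have strictMono_comap : StrictMono (Ideal.comap f) :=
    Monotone.strictMono_of_injective (fun _ _ h => Ideal.comap_mono h)
      (Ideal.comap_injective_of_surjective f hf)
  have not_lt_comap (I : Ideal R) : ¬ I < I.comap f := by
    induction I using WellFoundedGT.induction with
    | ind I ih => exact fun h => ih _ h (strictMono_comap h)
  rw [RingHom.injective_iff_ker_eq_bot]
  exact eq_bot_iff.2 (not_bot_lt_iff.1 (not_lt_comap ⊥)).le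

theorem ker_le_of_basis {K M N ι κ : Type*} [Ring K] [AddCommGroup M] [Module K M]
    [AddCommGroup N] [Module K N] (f : M →ₗ[K] N) (b : Module.Basis ι K M)
    (c : Module.Basis κ K N) (P : Submodule K M) (hf : ∀ i, f (b i) ≠ 0 → f (b i) ∈ Set.range c)
    (hP₀ : ∀ i, f (b i) = 0 → b i ∈ P)
    (hP : ∀ i j, f (b i) ≠ 0 → f (b i) = f (b j) → b i - b j ∈ P) : LinearMap.ker f ≤ P := by
  classical
  let L : N →ₗ[K] M ⧸ P := c.constr ℕ fun k =>
    if h : ∃ i, f (b i) = c k then P.mkQ (b h.choose) else 0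
  have hL : L ∘ₗ f = P.mkQ := b.ext fun i => by
    by_cases hi : f (b i) = 0
    · rw [LinearMap.comp_apply, hi, map_zero]
      exact ((Submodule.Quotient.mk_eq_zero P).2 (hP₀ i hi)).symm
    · obtain ⟨k, hk⟩ := hf i hi
      have hex : ∃ i, f (b i) = c k := ⟨i, hk.symm⟩
      have hchoose : f (b i) = f (b hex.choose) := hk.symm.trans hex.choose_spec.symm
      rw [LinearMap.comp_apply, ← hk, Module.Basis.constr_basis, dif_pos hex]
      exact ((Submodule.Quotient.eq P).2 (hP i _ hi hchoose)).symm
  rw [← P.ker_mkQ, ← hL]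
  exact LinearMap.ker_le_ker_comp f L

theorem ne_zero_of_prod_pow_ne_zero {σ M : Type*} [CommMonoidWithZero M] {q : σ → M} {α : σ →₀ ℕ}
    (h : (α.prod fun s k => q s ^ k) ≠ 0) {s : σ} (hs : s ∈ α.support) : q s ≠ 0 := fun h0 =>
  h (Finset.prod_eq_zero hs (by simp only [h0, zero_pow (Finsupp.mem_support_iff.1 hs)]))

theorem map_prod_pow_of_ne_zero {σ M N F : Type*} [CommMonoidWithZero M] [CommMonoid N]
    [FunLike F M N] [MonoidHomClass F M N] {q : σ → M} {u : σ → N} (θ : F)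
    (hθ : ∀ s, q s ≠ 0 → θ (q s) = u s) {α : σ →₀ ℕ} (h : (α.prod fun s k => q s ^ k) ≠ 0) :
    θ (α.prod fun s k => q s ^ k) = α.prod fun s k => u s ^ k := by
  rw [map_finsuppProd]
  refine Finsupp.prod_congr fun s hs => ?_
  rw [map_pow, hθ s (ne_zero_of_prod_pow_ne_zero h hs)]

open MvPolynomial in
theorem ker_aeval_le_of_monomial {K σ τ : Type*} [CommRing K] [Nontrivial K]
    {f : σ → MvPolynomial τ K} {I : Ideal (MvPolynomial σ K)}
    (hf : ∀ s, f s ≠ 0 → ∃ m, f s = monomial m 1) (hI₀ : ∀ s, f s = 0 → X s ∈ I)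
    (hI : ∀ α β : σ →₀ ℕ, (α.prod fun s k => f s ^ k) ≠ 0 →
      (α.prod fun s k => f s ^ k) = (β.prod fun s k => f s ^ k) →
        monomial α 1 - monomial β 1 ∈ I) :
    RingHom.ker (aeval f : MvPolynomial σ K →ₐ[K] MvPolynomial τ K) ≤ I := by
  have aeval_monomial_one (α : σ →₀ ℕ) :
      aeval f (monomial α (1 : K)) = α.prod fun s k => f s ^ k := by
    rw [aeval_monomial, map_one, one_mul]
  have prod_mem_range (α : σ →₀ ℕ) (hα : ∀ s ∈ α.support, f s ≠ 0) :
      ∃ m, monomial m 1 = α.prod fun s k => f s ^ k := by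
    refine Submonoid.prod_mem (MonoidHom.mrange (monomialOneHom K τ)) fun s hs => pow_mem ?_ _
    exact (hf s (hα s hs)).imp fun m hm => hm.symm
  refine ker_le_of_basis (aeval f).toLinearMap (basisMonomials σ K) (basisMonomials τ K)
    (I.restrictScalars K) (fun α hα => ?_) (fun α hα => ?_) fun α β hα hαβ => ?_
  · simp only [coe_basisMonomials, AlgHom.toLinearMap_apply, aeval_monomial_one] at hα ⊢
    exact prod_mem_range α fun s => ne_zero_of_prod_pow_ne_zero hα
  · simp only [coe_basisMonomials, AlgHom.toLinearMap_apply, aeval_monomial_one,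
      Submodule.restrictScalars_mem] at hα ⊢
    obtain ⟨s, hs, hs0⟩ : ∃ s ∈ α.support, f s = 0 := by
      by_contra! hne
      obtain ⟨m, hm⟩ := prod_mem_range α hne
      exact one_ne_zero (monomial_eq_zero.1 (hm.trans hα))
    rw [monomial_eq, C_1, one_mul]
    exact Ideal.mem_of_dvd _ (Finset.dvd_prod_of_mem _ hs)
      (Ideal.pow_mem_of_mem _ (hI₀ s hs0) _ (Finsupp.mem_support_iff.1 hs).bot_lt)
  · simp only [coe_basisMonomials, AlgHom.toLinearMap_apply, aeval_monomial_one] at hα hαβ ⊢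
    exact hI α β hα hαβ

end Algebra

section Generic

variable {𝕂 : Type*} [Field 𝕂] {n : ℕ} {a : Fin n → ℕ} {C : Type*} [CommRing C] [Algebra 𝕂 C]
  {Γ : Finset (Finset (Fin n))} {J J' : Finset (Fin n)} {w : Cell a}

theorem mem_mainIdeal {x : TableRing 𝕂 a} (hx : x ∈ (tau 𝕂 a Γ).range)
    (h : segreMap 𝕂 a x = 0) : x ∈ mainIdeal 𝕂 a Γ := by
  obtain ⟨z, rfl⟩ := hx
  exact Ideal.mem_map_of_mem _ h

variable [∀ j, NeZero (a j)]

theorem faceSum_mem_range_tau (hw : InFace Γ w) :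
    faceSum (generic 𝕂 a) w ∈ (tau 𝕂 a Γ).range := by
  obtain ⟨J, hJ, hw⟩ := hw
  exact forall_margin_mem_iff (M := (tau 𝕂 a Γ).range.toSubring.toAddSubgroup).1
    (fun b => ⟨MvPolynomial.X ⟨⟨J, hJ⟩, b⟩, by simp [tau]⟩) w hw

theorem margin_mem_range_tau (hJ' : J' ∈ Γ) (hJ : J ⊆ J') (b : MarginCell a J) :
    margin (generic 𝕂 a) J b ∈ (tau 𝕂 a Γ).range :=
  forall_margin_mem_iff (M := (tau 𝕂 a Γ).range.toSubring.toAddSubgroup).2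
    (fun _ hw => faceSum_mem_range_tau ⟨J', hJ', hw.trans hJ⟩) b

theorem segreIdeal_margin_le_mainIdeal (hJ' : J' ∈ Γ) (hJ : J ⊆ J') :
    segreIdeal (margin (generic 𝕂 a) J) ≤ mainIdeal 𝕂 a Γ := by
  refine Ideal.span_le.2 ?_
  rintro _ ⟨l, b, b', rfl⟩
  have hmem := margin_mem_range_tau (𝕂 := 𝕂) (a := a) hJ' hJ
  refine mem_mainIdeal ?_ ?_
  · rw [minor, Matrix.det_fin_two_of]
    exact sub_mem (mul_mem (hmem _) (hmem _)) (mul_mem (hmem _) (hmem _))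
  · simp only [map_minor, map_margin]
    refine minor_margin_eq_zero (fun l i i' => ?_) J l b b'
    simpa [segreMap, generic] using minor_prod (fun j c => MvPolynomial.X (Sigma.mk j c)) l i i'

theorem segreMap_faceSum (w : Cell a) :
    segreMap 𝕂 a (faceSum (generic 𝕂 a) w) =
      ∏ j, ∑ c ∈ slot (w j), MvPolynomial.X (Sigma.mk j c) := by
  simp [faceSum_eq_boxSum, boxSum, segreMap, generic, Finset.prod_univ_sum]

theorem exists_algHom_segreMap_faceSum (η : ∀ j, Fin (a j) → C) :
    ∃ φ : MvPolynomial (Σ j : Fin n, Fin (a j)) 𝕂 →ₐ[𝕂] C,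
      ∀ w, φ (segreMap 𝕂 a (faceSum (generic 𝕂 a) w)) = ∏ j, η j (w j) := by
  choose y hy using fun j => exists_sum_slot_eq (η j)
  exact ⟨MvPolynomial.aeval fun s => y s.1 s.2, fun w => by simp [segreMap_faceSum, hy]⟩

theorem mainIdeal_le_ker (g : TableRing 𝕂 a →ₐ[𝕂] C) (η : ∀ j, Fin (a j) → C)
    (h : ∀ w, InFace Γ w → g (faceSum (generic 𝕂 a) w) = ∏ j, η j (w j)) :
    mainIdeal 𝕂 a Γ ≤ RingHom.ker g := by
  obtain ⟨φ, hφ⟩ := exists_algHom_segreMap_faceSum (𝕂 := 𝕂) η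
  have comp_tau : g.comp (tau 𝕂 a Γ) = φ.comp (sigma 𝕂 a Γ) := by
    refine MvPolynomial.algHom_ext fun s => ?_
    have : g (margin (generic 𝕂 a) s.1.1 s.2) = φ (segreMap 𝕂 a (margin (generic 𝕂 a) _ s.2)) :=
      forall_margin_mem_iff (M := AddMonoidHom.eqLocus (g : TableRing 𝕂 a →+ C)
        (φ.comp (segreMap 𝕂 a) : TableRing 𝕂 a →+ C)).2
        (fun w hw => (h w ⟨_, s.1.2, hw⟩).trans (hφ w).symm) s.2
    simpa [sigma, tau] using this
  refine Ideal.map_le_iff_le_comap.2 fun x hx => ?_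
  calc g (tau 𝕂 a Γ x) = φ (sigma 𝕂 a Γ x) := DFunLike.congr_fun comp_tau x
    _ = 0 := by rw [RingHom.mem_ker.1 hx, map_zero]

theorem faceSum_mem_marginsIdeal (hw : InFace Γ w) :
    faceSum (generic 𝕂 a) w ∈ marginsIdeal 𝕂 a Γ := by
  obtain ⟨J, hJ, hw⟩ := hw
  have hle : marginIdeal 𝕂 a J ≤ marginsIdeal 𝕂 a Γ :=
    le_iSup₂ (f := fun J _ => marginIdeal 𝕂 a J) J hJ
  exact forall_margin_mem_iff (M := (marginsIdeal 𝕂 a Γ).toAddSubgroup).1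
    (fun b => hle (Ideal.subset_span ⟨b, rfl⟩)) w hw

theorem marginsIdeal_le {I : Ideal (TableRing 𝕂 a)}
    (h : ∀ w, InFace Γ w → faceSum (generic 𝕂 a) w ∈ I) : marginsIdeal 𝕂 a Γ ≤ I := by
  refine iSup₂_le fun J hJ => Ideal.span_le.2 (Set.range_subset_iff.2 ?_)
  exact forall_margin_mem_iff (M := I.toAddSubgroup).2 fun w hw => h w ⟨J, hJ, hw⟩

variable (𝕂 a) in
/-- The linear substitution of the face sums for the entries of the generic table. -/
noncomputable def faceMap : TableRing 𝕂 a →ₐ[𝕂] TableRing 𝕂 a :=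
  MvPolynomial.aeval (faceSum (generic 𝕂 a))

theorem faceMap_bijective : Function.Bijective (faceMap 𝕂 a) := by
  have faceMap_X (w : Cell a) : faceMap 𝕂 a (MvPolynomial.X w) = faceSum (generic 𝕂 a) w :=
    MvPolynomial.aeval_X _ _
  have surjective : Function.Surjective (faceMap 𝕂 a) := by
    rw [← AlgHom.range_eq_top, eq_top_iff, ← MvPolynomial.adjoin_range_X, Algebra.adjoin_le_iff]
    rintro _ ⟨i, rfl⟩
    have := forall_margin_mem_iff (J := Finset.univ)
      (M := (faceMap 𝕂 a).range.toSubring.toAddSubgroup).2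
      (fun w _ => ⟨MvPolynomial.X w, faceMap_X w⟩) (Finset.univ.restrict i)
    simpa [margin_restrict_eq_boxSum, boxSum, generic, Fintype.piFinset_singleton] using this
  exact ⟨injective_of_surjective_of_isNoetherianRing (f := (faceMap 𝕂 a).toRingHom) surjective,
    surjective⟩

variable (𝕂 a) in
/-- The change of coordinates `faceMap` as an automorphism of the polynomial ring. -/
noncomputable def faceEquiv : TableRing 𝕂 a ≃ₐ[𝕂] TableRing 𝕂 a :=
  AlgEquiv.ofBijective (faceMap 𝕂 a) faceMap_bijective

theorem faceEquiv_symm_faceSum (w : Cell a) :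
    (faceEquiv 𝕂 a).symm (faceSum (generic 𝕂 a) w) = MvPolynomial.X w := by
  simp [AlgEquiv.symm_apply_eq, faceEquiv, faceMap]

end Generic

section Component

variable {𝕂 : Type*} [Field 𝕂] {n : ℕ} {a : Fin n → ℕ}
  {Δ : Finset (Finset (Fin n))} {π : Finpartition (facets Δ)}
  {κ : Finset (Finset (Fin n)) → Finset (Fin n)} {Γ Γ' : Finset (Finset (Fin n))} {w : Cell a}

theorem mem_facets {J : Finset (Fin n)} : J ∈ facets Δ ↔ Maximal (fun F => F ∈ Δ) J := by
  simpa [facets] using fun h : Maximal (fun F => F ∈ Δ) J => h.prop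

theorem exists_facet {J : Finset (Fin n)} (hJ : J ∈ Δ) : ∃ J' ∈ facets Δ, J ⊆ J' := by
  obtain ⟨J', hJJ', hJ'⟩ := Δ.exists_le_maximal hJ
  exact ⟨J', mem_facets.2 hJ', hJJ'⟩

theorem mainIdeal_le_componentIdeal (hΓ : Γ ∈ π.parts) :
    mainIdeal 𝕂 a Γ ≤ componentIdeal 𝕂 a π κ :=
  le_sup_of_le_left (le_iSup₂_of_le (f := fun Γ _ => mainIdeal 𝕂 a Γ) Γ hΓ le_rfl)

variable [∀ j, NeZero (a j)]

theorem independenceIdeal_le_componentIdeal :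
    independenceIdeal 𝕂 a Δ ≤ componentIdeal 𝕂 a π κ := by
  refine iSup₂_le fun J hJ => ?_
  obtain ⟨J', hJ', hJJ'⟩ := exists_facet hJ
  obtain ⟨Γ, hΓ, hJ'Γ⟩ := π.exists_mem hJ'
  exact (segreIdeal_margin_le_mainIdeal hJ'Γ hJJ').trans (mainIdeal_le_componentIdeal hΓ)

theorem inFace_deleteVertex {k : Fin n} :
    InFace (deleteVertex Γ k) w ↔ InFace Γ w ∧ w k = 0 := by
  simp only [InFace, deleteVertex, Finset.exists_mem_image, Finset.subset_erase, mem_support,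
    not_not]
  exact ⟨fun ⟨J, hJ, hw, hk⟩ => ⟨⟨J, hJ, hw⟩, hk⟩, fun ⟨⟨J, hJ, hw⟩, hk⟩ => ⟨J, hJ, hw, hk⟩⟩

theorem faceSum_mem_componentIdeal (hΓ : Γ ∈ π.parts) (hw : InFace Γ w) (h : ¬ κ Γ ⊆ support w) :
    faceSum (generic 𝕂 a) w ∈ componentIdeal 𝕂 a π κ := by
  obtain ⟨k, hk, hkw⟩ := Finset.not_subset.1 h
  have hle : marginsIdeal 𝕂 a (deleteVertex Γ k) ≤ componentIdeal 𝕂 a π κ :=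
    le_sup_of_le_right (le_iSup₂_of_le
      (f := fun Γ _ => ⨆ k ∈ κ Γ, marginsIdeal 𝕂 a (deleteVertex Γ k)) Γ hΓ
      (le_iSup₂ (f := fun k _ => marginsIdeal 𝕂 a (deleteVertex Γ k)) k hk))
  exact hle (faceSum_mem_marginsIdeal (inFace_deleteVertex.2 ⟨hw, by simpa using hkw⟩))

theorem componentIdeal_le_ker {C : Type*} [CommRing C] [Algebra 𝕂 C] (g : TableRing 𝕂 a →ₐ[𝕂] C)
    (hprod : ∀ Γ ∈ π.parts, ∃ η : ∀ j, Fin (a j) → C,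
      ∀ w, InFace Γ w → g (faceSum (generic 𝕂 a) w) = ∏ j, η j (w j))
    (hzero : ∀ Γ ∈ π.parts, ∀ w, InFace Γ w → ¬ κ Γ ⊆ support w →
      g (faceSum (generic 𝕂 a) w) = 0) :
    componentIdeal 𝕂 a π κ ≤ RingHom.ker g := by
  refine sup_le (iSup₂_le fun Γ hΓ => ?_) (iSup₂_le fun Γ hΓ => iSup₂_le fun k hk => ?_)
  · obtain ⟨η, hη⟩ := hprod Γ hΓ
    exact mainIdeal_le_ker g η hη
  · refine marginsIdeal_le fun w hw => hzero Γ hΓ w (inFace_deleteVertex.1 hw).1 fun hsub => ?_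
    exact mem_support.1 (hsub hk) (inFace_deleteVertex.1 hw).2

/-- The cells `w` in `Γ` whose face sums are not killed by the ideals `L_{Γ ∖ k}`, `k ∈ κ Γ`. -/
def Active (κ : Finset (Finset (Fin n)) → Finset (Fin n)) (Γ : Finset (Finset (Fin n)))
    (w : Cell a) : Prop := InFace Γ w ∧ κ Γ ⊆ support w

theorem Active.eq_of_inFace (hκ : Admissible π κ) (hΓ : Γ ∈ π.parts) (hΓ' : Γ' ∈ π.parts)
    (h : Active κ Γ w) (h' : InFace Γ' w) : Γ = Γ' := by
  obtain ⟨J, hJ, hw⟩ := h'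
  by_contra hne
  have hJΓ : J ∉ Γ := fun hJΓ => hne (π.eq_of_mem_parts hΓ hΓ' hJΓ hJ)
  exact Finset.sdiff_nonempty.1 ((hκ Γ hΓ).2 J (π.le hΓ' hJ) hJΓ) (h.2.trans hw)

variable (𝕂 a) in
/-- The coordinate ring of the space parametrizing a component: a set of Segre parameters for each
part of the partition of the facets, and a free variable for each cell. Only those attached to
actual parts, and to cells outside all facets, occur in `paramValue`. -/
abbrev ParamRing :=
  MvPolynomial ((Finset (Finset (Fin n)) × Σ j : Fin n, Fin (a j)) ⊕ Cell a) 𝕂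

open Classical in
variable (𝕂) in
/-- The value of the face sum at `w` in the parametrization of a component. If the pair `(π, κ)` is
admissible then the sum has at most one term. -/
noncomputable def paramValue (π : Finpartition (facets Δ))
    (κ : Finset (Finset (Fin n)) → Finset (Fin n)) (w : Cell a) : ParamRing 𝕂 a :=
  if ∃ Γ ∈ π.parts, InFace Γ w then
    ∑ Γ ∈ π.parts with Active κ Γ w, ∏ j, MvPolynomial.X (Sum.inl (Γ, ⟨j, w j⟩))
  else MvPolynomial.X (Sum.inr w)

theorem paramValue_of_active (hκ : Admissible π κ) (hΓ : Γ ∈ π.parts) (h : Active κ Γ w) :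
    paramValue 𝕂 π κ w = ∏ j, MvPolynomial.X (Sum.inl (Γ, ⟨j, w j⟩)) := by
  classical
  rw [paramValue, if_pos ⟨Γ, hΓ, h.1⟩, Finset.sum_filter, Finset.sum_eq_single_of_mem Γ hΓ,
    if_pos h]
  exact fun Γ' hΓ' hne => if_neg fun h' => hne (h'.eq_of_inFace hκ hΓ' hΓ h.1)

theorem paramValue_of_not_subset (hκ : Admissible π κ) (hΓ : Γ ∈ π.parts) (hw : InFace Γ w)
    (h : ¬ κ Γ ⊆ support w) : paramValue 𝕂 π κ w = 0 := by
  classical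
  rw [paramValue, if_pos ⟨Γ, hΓ, hw⟩, Finset.sum_filter]
  refine Finset.sum_eq_zero fun Γ' hΓ' => if_neg fun h' => h ?_
  exact h'.eq_of_inFace hκ hΓ' hΓ hw ▸ h'.2

theorem paramValue_of_not_inFace (h : ¬ ∃ Γ ∈ π.parts, InFace Γ w) :
    paramValue 𝕂 π κ w = MvPolynomial.X (Sum.inr w) := if_neg h

theorem exists_active_of_paramValue_ne_zero (hκ : Admissible π κ) (h : paramValue 𝕂 π κ w ≠ 0)
    (hw : ∃ Γ ∈ π.parts, InFace Γ w) : ∃ Γ ∈ π.parts, Active κ Γ w := by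
  obtain ⟨Γ, hΓ, hw⟩ := hw
  exact ⟨Γ, hΓ, hw, not_not.1 fun hsub => h (paramValue_of_not_subset hκ hΓ hw hsub)⟩

theorem faceSum_mem_componentIdeal_of_paramValue_eq_zero (hκ : Admissible π κ)
    (h : paramValue 𝕂 π κ w = 0) : faceSum (generic 𝕂 a) w ∈ componentIdeal 𝕂 a π κ := by
  by_cases hw : ∃ Γ ∈ π.parts, InFace Γ w
  · obtain ⟨Γ, hΓ, hw⟩ := hw
    refine faceSum_mem_componentIdeal hΓ hw fun hsub => ?_
    rw [paramValue_of_active hκ hΓ ⟨hw, hsub⟩] at h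
    exact Finset.prod_ne_zero_iff.2 (fun j _ => MvPolynomial.X_ne_zero _) h
  · rw [paramValue_of_not_inFace hw] at h
    exact absurd h (MvPolynomial.X_ne_zero _)

theorem exists_paramValue_eq_monomial (hκ : Admissible π κ) (h : paramValue 𝕂 π κ w ≠ 0) :
    ∃ m, paramValue 𝕂 π κ w = MvPolynomial.monomial m 1 := by
  by_cases hw : ∃ Γ ∈ π.parts, InFace Γ w
  · obtain ⟨Γ, hΓ, hw⟩ := exists_active_of_paramValue_ne_zero hκ h hw
    exact ⟨_, (paramValue_of_active hκ hΓ hw).trans (MvPolynomial.monomial_sum_one _ _).symm⟩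
  · exact ⟨_, paramValue_of_not_inFace hw⟩

variable (𝕂 a) in
/-- The parametrization of a component: the homomorphism with `faceSum w ↦ paramValue w`. -/
noncomputable def paramMap (π : Finpartition (facets Δ))
    (κ : Finset (Finset (Fin n)) → Finset (Fin n)) : TableRing 𝕂 a →ₐ[𝕂] ParamRing 𝕂 a :=
  (MvPolynomial.aeval (paramValue 𝕂 π κ)).comp (faceEquiv 𝕂 a).symm.toAlgHom

theorem paramMap_faceSum (w : Cell a) :
    paramMap 𝕂 a π κ (faceSum (generic 𝕂 a) w) = paramValue 𝕂 π κ w := by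
  have : (faceEquiv 𝕂 a).symm.toAlgHom (faceSum (generic 𝕂 a) w) = MvPolynomial.X w :=
    faceEquiv_symm_faceSum w
  rw [paramMap, AlgHom.comp_apply, this, MvPolynomial.aeval_X]

theorem componentIdeal_le_ker_paramMap (hκ : Admissible π κ) :
    componentIdeal 𝕂 a π κ ≤ RingHom.ker (paramMap 𝕂 a π κ) := by
  classical
  refine componentIdeal_le_ker _ (fun Γ hΓ => ⟨fun j c => if j ∈ κ Γ ∧ c = 0 then 0 else
    MvPolynomial.X (Sum.inl (Γ, ⟨j, c⟩)), fun w hw => ?_⟩) fun Γ hΓ w hw h => ?_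
  · rw [paramMap_faceSum]
    by_cases h : κ Γ ⊆ support w
    · rw [paramValue_of_active hκ hΓ ⟨hw, h⟩]
      exact Finset.prod_congr rfl fun j _ => (if_neg fun hj => mem_support.1 (h hj.1) hj.2).symm
    · rw [paramValue_of_not_subset hκ hΓ hw h]
      obtain ⟨k, hk, hkw⟩ := Finset.not_subset.1 h
      have hk0 : w k = 0 := by simpa using hkw
      exact (Finset.prod_eq_zero (Finset.mem_univ k) (by simp [hk, hk0])).symm
  · rw [paramMap_faceSum, paramValue_of_not_subset hκ hΓ hw h]

open Classical in
variable (𝕂) in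
/-- The factor of the face sum at `w` that is parametrized by the variables of the part `Γ`. -/
noncomputable def partFactor (κ : Finset (Finset (Fin n)) → Finset (Fin n))
    (Γ : Finset (Finset (Fin n))) (w : Cell a) : TableRing 𝕂 a :=
  if Active κ Γ w then faceSum (generic 𝕂 a) w else 1

open Classical in
variable (𝕂) in
/-- The factor of the face sum at `w` that is parametrized by a free variable. -/
noncomputable def freeFactor (π : Finpartition (facets Δ)) (w : Cell a) : TableRing 𝕂 a :=
  if ∃ Γ ∈ π.parts, InFace Γ w then 1 else faceSum (generic 𝕂 a) w

theorem faceSum_eq_freeFactor_mul_prod (hκ : Admissible π κ) (h : paramValue 𝕂 π κ w ≠ 0) :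
    faceSum (generic 𝕂 a) w = freeFactor 𝕂 π w * ∏ Γ ∈ π.parts, partFactor 𝕂 κ Γ w := by
  by_cases hw : ∃ Γ ∈ π.parts, InFace Γ w
  · obtain ⟨Γ, hΓ, hact⟩ := exists_active_of_paramValue_ne_zero hκ h hw
    rw [freeFactor, if_pos hw, one_mul, Finset.prod_eq_single_of_mem Γ hΓ, partFactor, if_pos hact]
    exact fun Γ' hΓ' hne => if_neg fun h' => hne (h'.eq_of_inFace hκ hΓ' hΓ hact.1)
  · rw [freeFactor, if_neg hw, Finset.prod_eq_one, mul_one]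
    exact fun Γ hΓ => if_neg fun hact => hw ⟨Γ, hΓ, hact.1⟩

theorem partFactor_mem_range_tau (w : Cell a) : partFactor 𝕂 κ Γ w ∈ (tau 𝕂 a Γ).range := by
  unfold partFactor
  split_ifs with h
  · exact faceSum_mem_range_tau h.1
  · exact one_mem _

theorem exists_algHom_paramValue_eq_segreMap_partFactor (hκ : Admissible π κ)
    (hΓ : Γ ∈ π.parts) :
    ∃ θ : ParamRing 𝕂 a →ₐ[𝕂] MvPolynomial (Σ j : Fin n, Fin (a j)) 𝕂,
      ∀ w, paramValue 𝕂 π κ w ≠ 0 →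
        θ (paramValue 𝕂 π κ w) = segreMap 𝕂 a (partFactor 𝕂 κ Γ w) := by
  classical
  refine ⟨MvPolynomial.aeval (Sum.elim (fun s => if s.1 = Γ then
    ∑ c ∈ slot s.2.2, MvPolynomial.X (Sigma.mk s.2.1 c) else 1) fun _ => 1), fun w h => ?_⟩
  by_cases hw : ∃ Γ ∈ π.parts, InFace Γ w
  · obtain ⟨Γ', hΓ', hact⟩ := exists_active_of_paramValue_ne_zero hκ h hw
    rw [paramValue_of_active hκ hΓ' hact, map_prod]
    rcases eq_or_ne Γ' Γ with rfl | hne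
    · simp [partFactor, if_pos hact, segreMap_faceSum]
    · have hact' : ¬ Active κ Γ w := fun h' => hne (h'.eq_of_inFace hκ hΓ hΓ' hact.1).symm
      simp [partFactor, if_neg hact', hne]
  · have hact : ¬ Active κ Γ w := fun hact => hw ⟨Γ, hΓ, hact.1⟩
    simp [paramValue_of_not_inFace hw, partFactor, if_neg hact]

theorem exists_algHom_paramValue_eq_freeFactor (hκ : Admissible π κ) :
    ∃ θ : ParamRing 𝕂 a →ₐ[𝕂] TableRing 𝕂 a,
      ∀ w, paramValue 𝕂 π κ w ≠ 0 → θ (paramValue 𝕂 π κ w) = freeFactor 𝕂 π w := by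
  refine ⟨MvPolynomial.aeval (Sum.elim (fun _ => 1) (faceSum (generic 𝕂 a))), fun w h => ?_⟩
  by_cases hw : ∃ Γ ∈ π.parts, InFace Γ w
  · obtain ⟨Γ, hΓ, hact⟩ := exists_active_of_paramValue_ne_zero hκ h hw
    simp [paramValue_of_active hκ hΓ hact, freeFactor, if_pos hw]
  · simp [paramValue_of_not_inFace hw, freeFactor, if_neg hw]

theorem prod_faceSum_pow_eq (hκ : Admissible π κ) {α : Cell a →₀ ℕ}
    (hα : (α.prod fun w k => paramValue 𝕂 π κ w ^ k) ≠ 0) :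
    (α.prod fun w k => faceSum (generic 𝕂 a) w ^ k) = (α.prod fun w k => freeFactor 𝕂 π w ^ k) *
      ∏ Γ ∈ π.parts, α.prod fun w k => partFactor 𝕂 κ Γ w ^ k := by
  simp only [Finsupp.prod]
  rw [Finset.prod_comm, ← Finset.prod_mul_distrib]
  refine Finset.prod_congr rfl fun w hw => ?_
  rw [faceSum_eq_freeFactor_mul_prod hκ (ne_zero_of_prod_pow_ne_zero hα hw), mul_pow,
    Finset.prod_pow]

theorem prod_faceSum_pow_sub_mem_componentIdeal (hκ : Admissible π κ) {α β : Cell a →₀ ℕ}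
    (hα : (α.prod fun w k => paramValue 𝕂 π κ w ^ k) ≠ 0)
    (hαβ : (α.prod fun w k => paramValue 𝕂 π κ w ^ k) = β.prod fun w k => paramValue 𝕂 π κ w ^ k) :
    (α.prod fun w k => faceSum (generic 𝕂 a) w ^ k) -
      (β.prod fun w k => faceSum (generic 𝕂 a) w ^ k) ∈ componentIdeal 𝕂 a π κ := by
  have hβ : (β.prod fun w k => paramValue 𝕂 π κ w ^ k) ≠ 0 := hαβ ▸ hα
  have free_eq : (α.prod fun w k => freeFactor 𝕂 π w ^ k) =
      β.prod fun w k => freeFactor 𝕂 π w ^ k := by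
    obtain ⟨θ, hθ⟩ := exists_algHom_paramValue_eq_freeFactor (𝕂 := 𝕂) (a := a) hκ
    rw [← map_prod_pow_of_ne_zero θ hθ hα, hαβ, map_prod_pow_of_ne_zero θ hθ hβ]
  have part_sub_mem (Γ) (hΓ : Γ ∈ π.parts) : (α.prod fun w k => partFactor 𝕂 κ Γ w ^ k) -
      (β.prod fun w k => partFactor 𝕂 κ Γ w ^ k) ∈ mainIdeal 𝕂 a Γ := by
    obtain ⟨θ, hθ⟩ := exists_algHom_paramValue_eq_segreMap_partFactor (𝕂 := 𝕂) (a := a) hκ hΓ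
    have mem_range (α : Cell a →₀ ℕ) :
        (α.prod fun w k => partFactor 𝕂 κ Γ w ^ k) ∈ (tau 𝕂 a Γ).range :=
      prod_mem fun w _ => pow_mem (partFactor_mem_range_tau w) _
    refine mem_mainIdeal (sub_mem (mem_range α) (mem_range β)) ?_
    simp only [map_sub, map_finsuppProd, map_pow]
    rw [← map_prod_pow_of_ne_zero θ hθ hα, hαβ, map_prod_pow_of_ne_zero θ hθ hβ, sub_self]
  rw [prod_faceSum_pow_eq hκ hα, prod_faceSum_pow_eq hκ hβ, free_eq, ← mul_sub]
  refine Ideal.mul_mem_left _ _ (Ideal.Quotient.eq.1 ?_)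
  rw [map_prod, map_prod]
  exact Finset.prod_congr rfl fun Γ hΓ =>
    Ideal.Quotient.eq.2 (mainIdeal_le_componentIdeal hΓ (part_sub_mem Γ hΓ))

theorem ker_aeval_paramValue_le (hκ : Admissible π κ) :
    RingHom.ker (MvPolynomial.aeval (R := 𝕂) (paramValue (a := a) 𝕂 π κ)) ≤
      (componentIdeal 𝕂 a π κ).comap (faceMap 𝕂 a) := by
  refine ker_aeval_le_of_monomial (fun w => exists_paramValue_eq_monomial hκ) (fun w h => ?_)
    fun α β hα hαβ => ?_
  · rw [Ideal.mem_comap, faceMap, MvPolynomial.aeval_X]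
    exact faceSum_mem_componentIdeal_of_paramValue_eq_zero hκ h
  · rw [Ideal.mem_comap, map_sub, faceMap]
    simp only [MvPolynomial.aeval_monomial, map_one, one_mul]
    exact prod_faceSum_pow_sub_mem_componentIdeal hκ hα hαβ

theorem componentIdeal_eq_ker_paramMap (hκ : Admissible π κ) :
    componentIdeal 𝕂 a π κ = RingHom.ker (paramMap 𝕂 a π κ) := by
  refine (componentIdeal_le_ker_paramMap hκ).antisymm fun x hx => ?_
  have hmem : faceMap 𝕂 a ((faceEquiv 𝕂 a).symm x) ∈ componentIdeal 𝕂 a π κ :=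
    ker_aeval_paramValue_le hκ hx
  rwa [show faceMap 𝕂 a ((faceEquiv 𝕂 a).symm x) = x from (faceEquiv 𝕂 a).apply_symm_apply x]
    at hmem

theorem componentIdeal_isPrime (hκ : Admissible π κ) : (componentIdeal 𝕂 a π κ).IsPrime :=
  componentIdeal_eq_ker_paramMap (𝕂 := 𝕂) (a := a) hκ ▸ RingHom.ker_isPrime _

end Component

section CommonSupport

variable {ι : Type*} [Fintype ι] {α : ι → Type*} [∀ j, Zero (α j)] [∀ j, DecidableEq (α j)]
  {M : Type*} [Zero M] {T : (∀ j, α j) → M} {J : Finset ι} {w : ∀ j, α j}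

open Classical in
/-- The coordinates in `J` that are nonzero at each cell supported in `J` with a nonzero entry.
For the table of face sums modulo a minimal prime this recovers the set `K_i` attached to `J`. -/
noncomputable def commonSupport (T : (∀ j, α j) → M) (J : Finset ι) : Finset ι :=
  J.filter fun j => ∀ w, support w ⊆ J → T w ≠ 0 → w j ≠ 0

theorem mem_commonSupport {j : ι} :
    j ∈ commonSupport T J ↔ j ∈ J ∧ ∀ w, support w ⊆ J → T w ≠ 0 → w j ≠ 0 := by
  simp [commonSupport]

theorem commonSupport_subset : commonSupport T J ⊆ J := fun _ hj => (mem_commonSupport.1 hj).1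

theorem commonSupport_subset_support (hw : support w ⊆ J) (h : T w ≠ 0) :
    commonSupport T J ⊆ support w := fun _ hj =>
  mem_support.2 ((mem_commonSupport.1 hj).2 w hw h)

theorem commonSupport_of_forall_eq_zero (h : ∀ w, support w ⊆ J → T w = 0) :
    commonSupport T J = J :=
  commonSupport_subset.antisymm fun _ hj =>
    mem_commonSupport.2 ⟨hj, fun w hw h0 => (h0 (h w hw)).elim⟩

end CommonSupport

section RankOne

variable {ι : Type*} [Fintype ι] [DecidableEq ι] {α : ι → Type*} [∀ j, Zero (α j)]
  [∀ j, DecidableEq (α j)] {R F : Type*} [CommRing R] [Field F]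
  {J J' : Finset ι} {Γ : Finset (Finset ι)}

/-- The table `T` satisfies the equations of a rank-one tensor at the cells supported in `J`. -/
def RankOneOn (T : (∀ j, α j) → R) (J : Finset ι) : Prop :=
  ∀ l w v, support w ⊆ J → support v ⊆ J → minor T l w v = 0

theorem RankOneOn.mul_eq {T : (∀ j, α j) → R} (hT : RankOneOn T J) {w v : ∀ j, α j}
    (hw : support w ⊆ J) (hv : support v ⊆ J) (l : ι) :
    T w * T v = T (Function.update w l (v l)) * T (Function.update v l (w l)) :=
  minor_eq_zero_iff.1 (hT l w v hw hv)

theorem support_update_apply_subset {w v : ∀ j, α j} (hw : support w ⊆ J) (hv : support v ⊆ J)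
    (l : ι) : support (Function.update w l (v l)) ⊆ J :=
  support_update_subset hw fun h => hv (mem_support.2 h)

theorem rankOneOn_faceSum {n : ℕ} {a : Fin n → ℕ} [∀ j, NeZero (a j)] {A : Cell a → R}
    {J : Finset (Fin n)} (h : ∀ l b b', minor (margin A J) l b b' = 0) :
    RankOneOn (faceSum A) J := by
  intro l w v hw hv
  rw [minor_eq_zero_iff]
  by_cases hl : l ∈ J
  · let box (w : Cell a) (j : {j // j ∈ J}) : Finset (Fin (a j)) := slot (w j)
    have box_update (w v : Cell a) : box (Function.update w l (v l)) =
        Function.update (box w) ⟨l, hl⟩ (box v ⟨l, hl⟩) := by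
      ext1 j
      rcases eq_or_ne j ⟨l, hl⟩ with rfl | hj
      · simp [box]
      · simp [box, hj, Subtype.coe_ne_coe.2 hj]
    rw [faceSum_eq_boxSum_margin A hw, faceSum_eq_boxSum_margin A hv,
      faceSum_eq_boxSum_margin A (support_update_apply_subset hw hv l),
      faceSum_eq_boxSum_margin A (support_update_apply_subset hv hw l)]
    exact (boxSum_mul_boxSum (h ⟨l, hl⟩) (box w) (box v)).trans
      (by rw [← box_update, ← box_update])
  · have hwv : w l = v l := (eq_zero_of_notMem hw hl).trans (eq_zero_of_notMem hv hl).symm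
    rw [← hwv, Function.update_eq_self, hwv, Function.update_eq_self]

section NoZeroDivisors

variable [NoZeroDivisors R] {T : (∀ j, α j) → R} {w : ∀ j, α j}

theorem RankOneOn.exists_support_eq (hT : RankOneOn T J) (hw : support w ⊆ J) (h : T w ≠ 0) :
    ∃ w₀, support w₀ = commonSupport T J ∧ T w₀ ≠ 0 := by
  obtain ⟨w₀, ⟨hw₀, h0⟩, hmin⟩ := exists_minimalFor_of_wellFoundedLT
    (fun w => support w ⊆ J ∧ T w ≠ 0) support ⟨w, hw, h⟩
  refine ⟨w₀, subset_antisymm (fun j hj => ?_) (commonSupport_subset_support hw₀ h0), h0⟩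
  refine mem_commonSupport.2 ⟨hw₀ hj, fun v hv hv0 hvj => ?_⟩
  -- Otherwise moving the zero `v j` into `w₀` contradicts the minimality of `support w₀`.
  have hne : T (Function.update w₀ j (v j)) ≠ 0 :=
    left_ne_zero_of_mul (hT.mul_eq hw₀ hv j ▸ mul_ne_zero h0 hv0)
  have hle : support w₀ ⊆ support (Function.update w₀ j (v j)) :=
    hmin ⟨support_update_apply_subset hw₀ hv j, hne⟩
      (support_update_subset subset_rfl fun h => absurd hvj h)
  simpa [hvj] using hle hj

theorem RankOneOn.commonSupport_eq (hT : RankOneOn T J) (hT' : RankOneOn T J')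
    (hw : support w ⊆ J) (h : T w ≠ 0) (hJ' : commonSupport T J ⊆ J') :
    commonSupport T J = commonSupport T J' := by
  obtain ⟨w₀, hs, h0⟩ := hT.exists_support_eq hw h
  have hw₀ : support w₀ ⊆ J' := hs ▸ hJ'
  have hsub : commonSupport T J' ⊆ commonSupport T J :=
    hs ▸ commonSupport_subset_support hw₀ h0
  obtain ⟨v, hv, hv0⟩ := hT'.exists_support_eq hw₀ h0
  refine subset_antisymm ?_ hsub
  exact hv ▸ commonSupport_subset_support (hv ▸ hsub.trans commonSupport_subset) hv0

end NoZeroDivisors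

variable {T : (∀ j, α j) → F}

theorem RankOneOn.eq_mul_prod (hT : RankOneOn T J) {w₀ w : ∀ j, α j} (hw₀ : support w₀ ⊆ J)
    (h0 : T w₀ ≠ 0) (hw : support w ⊆ J) :
    T w = T w₀ * ∏ j, T (Function.update w₀ j (w j)) / T w₀ := by
  have support_piecewise (Q : Finset ι) : support (Q.piecewise w w₀) ⊆ J := fun j hj => by
    by_cases hjQ : j ∈ Q
    · exact hw (by simpa [hjQ] using hj)
    · exact hw₀ (by simpa [hjQ] using hj)
  have eq_on (Q : Finset ι) :
      T (Q.piecewise w w₀) = T w₀ * ∏ j ∈ Q, T (Function.update w₀ j (w j)) / T w₀ := by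
    induction Q using Finset.induction_on with
    | empty => simp
    | insert k Q hk ih =>
      have hmul := hT.mul_eq (support_piecewise (insert k Q)) hw₀ k
      rw [Finset.piecewise_insert, Function.update_self, Function.update_idem,
        ← Finset.piecewise_eq_of_notMem Q w w₀ hk, Function.update_eq_self, ih] at hmul
      rw [Finset.piecewise_insert, Finset.prod_insert hk, eq_div_of_mul_eq h0 hmul]
      ring
  simpa using eq_on Finset.univ

theorem exists_forall_eq_prod [Nonempty ι] (hT : ∀ J ∈ Γ, RankOneOn T J)
    (hS : ∀ J ∈ Γ, ∀ J' ∈ Γ, commonSupport T J = commonSupport T J') :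
    ∃ η : ∀ j, α j → F, ∀ w, InFace Γ w → T w = ∏ j, η j (w j) := by
  let k : ι := Classical.arbitrary ι
  by_cases hz : ∀ w, InFace Γ w → T w = 0
  · exact ⟨0, fun w hw => (hz w hw).trans (Finset.prod_eq_zero (Finset.mem_univ k) rfl).symm⟩
  push Not at hz
  obtain ⟨w, ⟨J, hJ, hw⟩, h⟩ := hz
  obtain ⟨w₀, hs, h0⟩ := (hT J hJ).exists_support_eq hw h
  refine ⟨fun j c => (if j = k then T w₀ else 1) * (T (Function.update w₀ j c) / T w₀), ?_⟩
  rintro v ⟨J', hJ', hv⟩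
  rw [Finset.prod_mul_distrib, Finset.prod_ite_eq' Finset.univ, if_pos (Finset.mem_univ k)]
  refine (hT J' hJ').eq_mul_prod ?_ h0 hv
  rw [hs, hS J hJ J' hJ']
  exact commonSupport_subset

end RankOne

section MinimalPrimes

theorem exists_finpartition_forall_mem_iff {α β : Type*} [DecidableEq α] (f : α → β)
    (s : Finset α) :
    ∃ π : Finpartition s, ∀ p ∈ π.parts, ∀ x ∈ p, ∀ y, y ∈ p ↔ y ∈ s ∧ f y = f x := by
  classical
  let π := Finpartition.ofSetSetoid (Setoid.ker f) s
  refine ⟨π, fun p hp x hx y => ?_⟩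
  rw [← π.part_eq_of_mem hp hx, Finpartition.mem_part_ofSetSetoid_iff_rel, Setoid.ker_def, eq_comm,
    and_iff_right (π.le hp hx)]

variable {𝕂 : Type*} [Field 𝕂] {n : ℕ} {a : Fin n → ℕ} [∀ j, NeZero (a j)]
  {Δ : Finset (Finset (Fin n))} {R : Type*} [CommRing R]

theorem admissible_sup_commonSupport [NoZeroDivisors R] {T : Cell a → R}
    (hT : ∀ J ∈ facets Δ, RankOneOn T J) {π : Finpartition (facets Δ)}
    (hπ : ∀ Γ ∈ π.parts, ∀ J ∈ Γ, ∀ J', J' ∈ Γ ↔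
      J' ∈ facets Δ ∧ commonSupport T J' = commonSupport T J) :
    Admissible π fun Γ => Γ.sup (commonSupport T) := by
  intro Γ hΓ
  refine ⟨fun J hJ => Finset.sup_le fun J' hJ' => ?_, fun J hJ hJΓ => ?_⟩
  · exact ((hπ Γ hΓ J hJ J').1 hJ').2 ▸ commonSupport_subset
  obtain ⟨J', hJ'⟩ := π.nonempty_of_mem_parts hΓ
  have hJ'Δ : J' ∈ facets Δ := π.le hΓ hJ'
  rw [Finset.sdiff_nonempty]
  intro hsup
  have hsub : commonSupport T J' ⊆ J := (Finset.le_sup hJ').trans hsup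
  refine hJΓ ((hπ Γ hΓ J' hJ' J).2 ⟨hJ, ?_⟩)
  by_cases h : ∀ w, support w ⊆ J' → T w = 0
  · rw [commonSupport_of_forall_eq_zero h] at hsub
    rw [(mem_facets.1 hJ'Δ).eq_of_le (mem_facets.1 hJ).prop hsub]
  · push Not at h
    obtain ⟨w, hw, h⟩ := h
    exact ((hT J' hJ'Δ).commonSupport_eq (hT J hJ) hw h hsub).symm

theorem rankOneOn_of_independenceIdeal_le_ker [Algebra 𝕂 R] {g : TableRing 𝕂 a →ₐ[𝕂] R}
    (hg : independenceIdeal 𝕂 a Δ ≤ RingHom.ker g) {J : Finset (Fin n)} (hJ : J ∈ Δ) :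
    RankOneOn (fun w => g (faceSum (generic 𝕂 a) w)) J := by
  simp only [map_faceSum]
  refine rankOneOn_faceSum fun l b b' => ?_
  have hmem : minor (margin (generic 𝕂 a) J) l b b' ∈ independenceIdeal 𝕂 a Δ :=
    le_iSup₂ (f := fun J _ => segreIdeal (margin (generic 𝕂 a) J)) J hJ
      (Ideal.subset_span ⟨l, b, b', rfl⟩)
  simpa only [RingHom.mem_ker, map_minor, map_margin] using hg hmem

theorem exists_componentIdeal_le_ker [NeZero n] {F : Type*} [Field F] [Algebra 𝕂 F]
    {g : TableRing 𝕂 a →ₐ[𝕂] F} (hg : independenceIdeal 𝕂 a Δ ≤ RingHom.ker g) :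
    ∃ (π : Finpartition (facets Δ)) (κ : Finset (Finset (Fin n)) → Finset (Fin n)),
      Admissible π κ ∧ componentIdeal 𝕂 a π κ ≤ RingHom.ker g := by
  let T : Cell a → F := fun w => g (faceSum (generic 𝕂 a) w)
  have hT : ∀ J ∈ facets Δ, RankOneOn T J := fun J hJ =>
    rankOneOn_of_independenceIdeal_le_ker hg (mem_facets.1 hJ).prop
  obtain ⟨π, hπ⟩ := exists_finpartition_forall_mem_iff (commonSupport T) (facets Δ)
  refine ⟨π, _, admissible_sup_commonSupport hT hπ, componentIdeal_le_ker g (fun Γ hΓ => ?_) ?_⟩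
  · exact exists_forall_eq_prod (fun J hJ => hT J (π.le hΓ hJ))
      fun J hJ J' hJ' => ((hπ Γ hΓ J' hJ' J).1 hJ).2
  · rintro Γ hΓ w ⟨J, hJ, hw⟩ h
    by_contra h0
    refine h (Finset.sup_le fun J' hJ' => ?_)
    rw [((hπ Γ hΓ J hJ J').1 hJ').2]
    exact commonSupport_subset_support hw h0

theorem exists_componentIdeal_le [NeZero n] {p : Ideal (TableRing 𝕂 a)} [p.IsPrime]
    (h : independenceIdeal 𝕂 a Δ ≤ p) :
    ∃ (π : Finpartition (facets Δ)) (κ : Finset (Finset (Fin n)) → Finset (Fin n)),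
      Admissible π κ ∧ componentIdeal 𝕂 a π κ ≤ p := by
  let g : TableRing 𝕂 a →ₐ[𝕂] FractionRing (TableRing 𝕂 a ⧸ p) :=
    (IsScalarTower.toAlgHom 𝕂 (TableRing 𝕂 a ⧸ p) _).comp (Ideal.Quotient.mkₐ 𝕂 p)
  have ker_g : RingHom.ker g = p := by
    ext x
    rw [RingHom.mem_ker, AlgHom.comp_apply, IsScalarTower.coe_toAlgHom',
      map_eq_zero_iff _ (IsFractionRing.injective _ _)]
    exact Ideal.Quotient.eq_zero_iff_mem
  exact ker_g ▸ exists_componentIdeal_le_ker (g := g) (ker_g.symm ▸ h)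

end MinimalPrimes

end MarginalIndependence

theorem mainTheorem7_general {𝕂 : Type*} [Field 𝕂] {n : ℕ} (hn : 0 < n) (a : Fin n → ℕ)
    (ha : ∀ j, 0 < a j) (Δ : Finset (Finset (Fin n))) :
    (∀ (π : Finpartition (MarginalIndependence.facets Δ))
        (κ : Finset (Finset (Fin n)) → Finset (Fin n)),
        MarginalIndependence.Admissible π κ →
          (MarginalIndependence.componentIdeal 𝕂 a π κ).IsPrime) ∧
      ∀ 𝔭 ∈ (MarginalIndependence.independenceIdeal 𝕂 a Δ).minimalPrimes,
        ∃ (π : Finpartition (MarginalIndependence.facets Δ))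
          (κ : Finset (Finset (Fin n)) → Finset (Fin n)),
          MarginalIndependence.Admissible π κ ∧
            𝔭 = MarginalIndependence.componentIdeal 𝕂 a π κ := by
  have : NeZero n := ⟨hn.ne'⟩
  have : ∀ j, NeZero (a j) := fun j => ⟨(ha j).ne'⟩
  refine ⟨fun π κ => MarginalIndependence.componentIdeal_isPrime, fun 𝔭 h𝔭 => ?_⟩
  have : 𝔭.IsPrime := h𝔭.1.1
  obtain ⟨π, κ, hκ, hle⟩ := MarginalIndependence.exists_componentIdeal_le h𝔭.1.2
  have hprime := MarginalIndependence.componentIdeal_isPrime (𝕂 := 𝕂) (a := a) hκ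
  exact ⟨π, κ, hκ, (h𝔭.2 ⟨hprime, MarginalIndependence.independenceIdeal_le_componentIdeal⟩
    hle).antisymm hle⟩

theorem mainTheorem7 {𝕂 : Type*} [Field 𝕂] {n : ℕ} (hn : 0 < n) (a : Fin n → ℕ)
    (ha : ∀ j, 0 < a j) (Δ : Finset (Finset (Fin n)))
    (hΔ : IsLowerSet (Δ : Set (Finset (Fin n)))) :
    (∀ (π : Finpartition (MarginalIndependence.facets Δ))
        (κ : Finset (Finset (Fin n)) → Finset (Fin n)),
        MarginalIndependence.Admissible π κ →
          (MarginalIndependence.componentIdeal 𝕂 a π κ).IsPrime) ∧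
      ∀ 𝔭 ∈ (MarginalIndependence.independenceIdeal 𝕂 a Δ).minimalPrimes,
        ∃ (π : Finpartition (MarginalIndependence.facets Δ))
          (κ : Finset (Finset (Fin n)) → Finset (Fin n)),
          MarginalIndependence.Admissible π κ ∧
            𝔭 = MarginalIndependence.componentIdeal 𝕂 a π κ :=
  mainTheorem7_general hn a ha Δ
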